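/- Let $M$ be a gcd-monoid, that is, a cancellative monoid in which $1$ is the only invertible element and any two elements have a left-gcd and a right-gcd (with respect to left-division: $a$ left-divides $b$ if $b=ax$ for some $x\in M$, and right-division: $a$ right-divides $b$ if $b=xa$ for some $x\in M$). The right-lcm $a\vee b$ (resp. left-lcm $a\mathbin{\widetilde\vee} b$) of $a,b\in M$ is their least common right-multiple (resp. left-multiple), which exists as soon as $a,b$ have a common right-multiple (resp. left-multiple). An atom of $M$ is an element $a\neq 1$ that is not a product of two elements different from $1$. The right-basic elements are those obtained from atoms by repeatedly applying the partial operation $(a,b)\mapsto a\backslash b$ defined by $a(a\backslash b)=a\vee b$; the left-basic elements are those obtained from atoms by repeatedly applying $(a,b)\mapsto a/b$ defined by $(a/b)b=a\mathbin{\widetilde\vee} b$; an element is basic if it is right-basic or left-basic. Assume that $M$ is strongly noetherian, i.e. there is a map $\lambda$ from $M\setminus\{1\}$ to the positive integers with $\lambda(ab)\ge\lambda(a)+\lambda(b)$ for all $a,b\neq 1$, and that $M$ has only finitely many basic elements. Let $\mathcal U(M)$ be the enveloping group of $M$ and $\iota\colon M\to\mathcal U(M)$ the canonical morphism. A multifraction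 on $M$ is a finite sequence $\underline a=(a_1,\dots,a_n)$ of elements of $M$; it represents the element $\iota(a_1)\iota(a_2)^{-1}\iota(a_3)\cdots\iota(a_n)^{(-1)^{n-1}}$ of $\mathcal U(M)$. Write $\underline a\Rightarrow\underline b$ if $\underline b=(b_1,\dots,b_n)$ has the same length $n$ as $\underline a$ and there are $i$ with $1\le i<n$ and $x\neq 1$ in $M$ such that $b_k=a_k$ for $k\notin\{i-1,i,i+1\}$ and, for some $x'\in M$, * if $i$ is even: $b_{i-1}=a_{i-1}x'$, $\ xb_i=a_ix'=x\vee a_i$, $\ xb_{i+1}=a_{i+1}$; * if $i\ge 3$ is odd: $b_{i-1}=x'a_{i-1}$, $\ b_ix=x'a_i=x\mathbin{\widetilde\vee}a_i$, $\ b_{i+1}x=a_{i+1}$; * if $i=1$: $b_1x=a_1$, $\ b_2x=a_2$. Let $\Rightarrow^*$ be the reflexive-transitive closure of $\Rightarrow$. Let $f$ be a map from multifractions on $M$ to $\mathbb N$ that is Turing-computable, in the sense that it is induced by a Turing-computable map on finite sequences of words in the (finitely many) atoms of $M$. Assume that reduction is semi-convergent for $M$ up to $f$-padding: for every multifraction $\underline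 a$ that represents $1$ in $\mathcal U(M)$, the multifraction obtained from $\underline a$ by adding $2f(\underline a)$ entries $1$ on the left reduces under $\Rightarrow^*$ to a multifraction all of whose entries are $1$. Then the word problem of $\mathcal U(M)$ is decidable: $\mathcal U(M)$ is finitely generated and, for every finite generating family of $\mathcal U(M)$, the set of words in these generators and their inverses that represent $1$ is computable. -/

import Mathlib

namespace MultifractionReduction

section Monoids

variable {M : Type*} [Monoid M]

/-- `a` left-divides `b` (equivalently, `b` is a right-multiple of `a`). -/
def LeftDvd (a b : M) : Prop := ∃ x, b = a * x

/-- `a` right-divides `b` (equivalently, `b` is a left-multiple of `a`). -/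
def RightDvd (a b : M) : Prop := ∃ x, b = x * a

/-- `d` is a left-gcd of `a` and `b`. -/
def IsLeftGcd (a b d : M) : Prop :=
  LeftDvd d a ∧ LeftDvd d b ∧ ∀ c, LeftDvd c a → LeftDvd c b → LeftDvd c d

/-- `d` is a right-gcd of `a` and `b`. -/
def IsRightGcd (a b d : M) : Prop :=
  RightDvd d a ∧ RightDvd d b ∧ ∀ c, RightDvd c a → RightDvd c b → RightDvd c d

/-- `m` is a right-lcm of `a` and `b`: a least common right-multiple. -/
def IsRightLcm (a b m : M) : Prop :=
  LeftDvd a m ∧ LeftDvd b m ∧ ∀ c, LeftDvd a c → LeftDvd b c → LeftDvd m c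

/-- `m` is a left-lcm of `a` and `b`: a least common left-multiple. -/
def IsLeftLcm (a b m : M) : Prop :=
  RightDvd a m ∧ RightDvd b m ∧ ∀ c, RightDvd a c → RightDvd b c → RightDvd m c

variable (M) in
/-- Gcd-monoids: cancellative monoids in which `1` is the only invertible element and any two
elements have a left-gcd and a right-gcd. -/
structure IsGcdMonoid : Prop where
  cancel : IsCancelMul M
  eq_one_of_isUnit : ∀ a : M, IsUnit a → a = 1
  exists_leftGcd : ∀ a b : M, ∃ d, IsLeftGcd a b d
  exists_rightGcd : ∀ a b : M, ∃ d, IsRightGcd a b d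

variable (M) in
/-- Strong noetherianity: there is a map `l` from `M \ {1}` to the positive integers with
`l (a * b) ≥ l a + l b`. The value of `l` at `1` is irrelevant. -/
def StronglyNoetherian : Prop :=
  ∃ l : M → ℕ, (∀ a, a ≠ 1 → 0 < l a) ∧
    ∀ a b, a ≠ 1 → b ≠ 1 → a * b ≠ 1 → l a + l b ≤ l (a * b)

/-- Atoms: elements other than `1` that are not a product of two elements other than `1`. -/
def IsMonoidAtom (a : M) : Prop := a ≠ 1 ∧ ∀ b c, a = b * c → b = 1 ∨ c = 1

/-- Right-basic elements: the closure of the atoms under the partial operation `a \ b`, which is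
the element `c` such that `a * c` is the right-lcm of `a` and `b`, when the latter exists. -/
inductive IsRightBasic : M → Prop
  | atom {a : M} : IsMonoidAtom a → IsRightBasic a
  | under {a b c : M} : IsRightBasic a → IsRightBasic b → IsRightLcm a b (a * c) → IsRightBasic c

/-- Left-basic elements: the closure of the atoms under the partial operation `a / b`, which is
the element `c` such that `c * b` is the left-lcm of `a` and `b`, when the latter exists. -/
inductive IsLeftBasic : M → Prop
  | atom {a : M} : IsMonoidAtom a → IsLeftBasic a
  | over {a b c : M} : IsLeftBasic a → IsLeftBasic b → IsLeftLcm a b (c * b) → IsLeftBasic c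

variable (M) in
/-- There are finitely many basic (that is, right-basic or left-basic) elements. -/
def FinitelyManyBasic : Prop := {a : M | IsRightBasic a ∨ IsLeftBasic a}.Finite

end Monoids

section EnvelopingGroup

variable (M : Type*) [Monoid M]

/-- The relations `[a] [b] = [a * b]`, for `a` and `b` in `M`. -/
def envelopingRels : Set (FreeGroup M) :=
  {r | ∃ a b : M, r = FreeGroup.of a * FreeGroup.of b * (FreeGroup.of (a * b))⁻¹}

/-- The enveloping group (universal group, group of fractions in the sense of universal
morphisms) of `M`. -/
abbrev EnvelopingGroup : Type _ := PresentedGroup (envelopingRels M)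

theorem of_mul_of (a b : M) :
    (PresentedGroup.of (a * b) : EnvelopingGroup M) = PresentedGroup.of a * PresentedGroup.of b := by
  have h : (PresentedGroup.mk (envelopingRels M))
      (FreeGroup.of a * FreeGroup.of b * (FreeGroup.of (a * b))⁻¹) = 1 :=
    PresentedGroup.one_of_mem ⟨a, b, rfl⟩
  rw [map_mul, map_mul, map_inv, mul_inv_eq_one] at h
  exact h.symm

/-- The canonical morphism from `M` to its enveloping group. -/
def can : M →* EnvelopingGroup M :=
  MonoidHom.mk' (fun a => (PresentedGroup.of a : EnvelopingGroup M)) (of_mul_of M)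

end EnvelopingGroup

section Multifractions

variable {M : Type*} [Monoid M]

/-- A multifraction `a₁ / a₂ / ⋯ / aₙ` on `M` is a list `[a₁, a₂, …, aₙ]`. The element of the
enveloping group that it represents is `a₁ a₂⁻¹ a₃ a₄⁻¹ ⋯`. -/
def multifractionValue : List M → EnvelopingGroup M
  | [] => 1
  | [a] => can M a
  | a :: b :: l => can M a * (can M b)⁻¹ * multifractionValue l

/-- `RedAt i x a b` says that the multifraction `b` results from `a` by the elementary reduction
at level `i` (entries being numbered from `1`) with parameter `x`. In the last two rules, the
modified entries are those of indices `i - 1`, `i`, `i + 1`, where `i = u.length + 2`. -/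
inductive RedAt : ℕ → M → List M → List M → Prop
  | one {x a₁ a₂ b₁ b₂ : M} {v : List M} (h₁ : b₁ * x = a₁) (h₂ : b₂ * x = a₂) :
      RedAt 1 x (a₁ :: a₂ :: v) (b₁ :: b₂ :: v)
  | even {u v : List M} {x x' a₁ a₂ a₃ b₁ b₂ b₃ : M} (hi : Even (u.length + 2))
      (h₁ : b₁ = a₁ * x') (h₂ : x * b₂ = a₂ * x') (hl : IsRightLcm x a₂ (a₂ * x'))
      (h₃ : x * b₃ = a₃) :
      RedAt (u.length + 2) x (u ++ a₁ :: a₂ :: a₃ :: v) (u ++ b₁ :: b₂ :: b₃ :: v)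
  | odd {u v : List M} {x x' a₁ a₂ a₃ b₁ b₂ b₃ : M} (hi : Odd (u.length + 2))
      (h₁ : b₁ = x' * a₁) (h₂ : b₂ * x = x' * a₂) (hl : IsLeftLcm x a₂ (x' * a₂))
      (h₃ : b₃ * x = a₃) :
      RedAt (u.length + 2) x (u ++ a₁ :: a₂ :: a₃ :: v) (u ++ b₁ :: b₂ :: b₃ :: v)

/-- One step of reduction. -/
def Reduces (a b : List M) : Prop := ∃ i x, x ≠ 1 ∧ RedAt i x a b

/-- The multifraction of depth `n` with all entries equal to `1`. -/
def trivialMultifraction (M : Type*) [Monoid M] (n : ℕ) : List M := List.replicate n 1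

/-- Reduction is semi-convergent for `M` up to `f`-padding: if `a` represents `1`, then the
multifraction obtained from `a` by adding `2 * f a` entries `1` on the left reduces to a trivial
multifraction (which is of the same depth, since reduction preserves depth). -/
def SemiConvergentUpTo (f : List M → ℕ) : Prop :=
  ∀ a : List M, multifractionValue a = 1 →
    Relation.ReflTransGen Reduces (trivialMultifraction M (2 * f a) ++ a)
      (trivialMultifraction M (2 * f a + a.length))

/-- A map `f` on multifractions is Turing-computable if, for some enumeration of the finitely many
atoms of `M`, it is induced by a computable map on finite sequences of words in the atoms. -/
def IsTuringComputable (f : List M → ℕ) : Prop :=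
  ∃ (n : ℕ) (s : Fin n ≃ {a : M // IsMonoidAtom a}) (F : List (List (Fin n)) → ℕ),
    Computable F ∧
      ∀ ws : List (List (Fin n)), F ws = f (ws.map fun w => (w.map fun j => (s j : M)).prod)

end Multifractions

/-- The word problem of the group `G` is decidable: `G` is finitely generated and, for every
finite generating family `g`, the set of words in the letters `g j` and `(g j)⁻¹` that represent
`1` in `G` is computable. The letter `(j, true)` stands for `g j`, and `(j, false)` for
`(g j)⁻¹`. -/
def WordProblemDecidable (G : Type*) [Group G] : Prop :=
  Group.FG G ∧ ∀ (n : ℕ) (g : Fin n → G), Subgroup.closure (Set.range g) = ⊤ →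
    ComputablePred fun w : List (Fin n × Bool) => FreeGroup.lift g (FreeGroup.mk w) = 1

end MultifractionReduction

open MultifractionReduction

/-! Semi-convergence turns the word problem into a reachability question. Reduction preserves the
represented element (`RedAt.multifractionValue_eq`), so a multifraction `a` represents `1` exactly
when `a`, padded by `2 * f a` entries `1`, reduces to a trivial multifraction. Since `f` is
computable, it remains to decide reducibility to a trivial multifraction.

Strong noetherianity makes every element a product of atoms, makes reductions by atoms generate all
reductions (`RedAt.split`), and forces termination (`RedAt.shortlex`). There are finitely many
atoms, so each multifraction has finitely many atomic reducts, and a terminating, finitely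
branching, computable relation has decidable reachability (`computablePred_exists_reachable`).

Finiteness of the basic elements makes the reducts computable. The right-basic elements form a
finite set closed under complement, so a finite table gives the complements of letters, and filling
a grid with this table gives lcms of words (`isRightComplement_wordComplement`). Left-handed
statements follow in the opposite monoid. -/

/-! ### Decidable reachability for terminating, finitely branching relations. -/

section Computability

open Relation

variable {α : Type*}

/-- The elements reachable from the elements of a list in exactly `k` steps. -/
def reachLevel (next : α → List α) (k : ℕ) (L : List α) : List α :=
  (fun L => L.flatMap next)^[k] L

theorem reachLevel_succ (next : α → List α) (k : ℕ) (L : List α) :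
    reachLevel next (k + 1) L = reachLevel next k (L.flatMap next) := rfl

theorem primrec_reachLevel [Primcodable α] {next : α → List α} (h : Primrec next) :
    Primrec₂ (reachLevel next) :=
  Primrec.nat_iterate Primrec.fst Primrec.snd
    (Primrec.list_flatMap Primrec.snd (h.comp Primrec.snd).to₂).to₂

theorem mem_reachLevel {next : α → List α} {k : ℕ} {L : List α} {b : α} :
    b ∈ reachLevel next k L ↔ ∃ a ∈ L, b ∈ reachLevel next k [a] := by
  induction k generalizing L with
  | zero => simp [reachLevel]
  | succ k ih =>
    simp only [reachLevel_succ]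
    rw [ih]
    constructor
    · rintro ⟨c, hc, hb⟩
      obtain ⟨a, ha, hca⟩ := List.mem_flatMap.1 hc
      refine ⟨a, ha, ?_⟩
      rw [ih]
      exact ⟨c, by simpa using hca, hb⟩
    · rintro ⟨a, ha, hb⟩
      rw [ih] at hb
      obtain ⟨c, hc, hb⟩ := hb
      exact ⟨c, List.mem_flatMap.2 ⟨a, ha, by simpa using hc⟩, hb⟩

theorem mem_reachLevel_succ {next : α → List α} {k : ℕ} {a b : α} :
    b ∈ reachLevel next (k + 1) [a] ↔ ∃ c ∈ next a, b ∈ reachLevel next k [c] := by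
  rw [reachLevel_succ, mem_reachLevel]
  simp

theorem reflTransGen_iff_mem_reachLevel {next : α → List α} {a b : α} :
    ReflTransGen (fun a b => b ∈ next a) a b ↔ ∃ k, b ∈ reachLevel next k [a] := by
  constructor
  · intro h
    induction h using ReflTransGen.head_induction_on with
    | refl => exact ⟨0, by simp [reachLevel]⟩
    | head h _ ih =>
      obtain ⟨k, hk⟩ := ih
      exact ⟨k + 1, mem_reachLevel_succ.2 ⟨_, h, hk⟩⟩
  · rintro ⟨k, hk⟩
    induction k generalizing a with
    | zero =>
      obtain rfl : b = a := by simpa [reachLevel] using hk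
      exact .refl
    | succ k ih =>
      obtain ⟨c, hc, hb⟩ := mem_reachLevel_succ.1 hk
      exact .head hc (ih hb)

theorem reachLevel_eq_nil_of_le {next : α → List α} {k m : ℕ} (hkm : k ≤ m) {L : List α}
    (h : reachLevel next k L = []) : reachLevel next m L = [] := by
  obtain ⟨d, rfl⟩ := Nat.exists_eq_add_of_le' hkm
  rw [reachLevel, Function.iterate_add_apply, ← reachLevel, ← reachLevel, h]
  clear h hkm
  induction d with
  | zero => rfl
  | succ d ih => rw [reachLevel_succ]; exact ih

theorem exists_reachLevel_eq_nil {next : α → List α}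
    (wf : WellFounded fun b a => b ∈ next a) (a : α) : ∃ k, reachLevel next k [a] = [] := by
  induction a using wf.induction with
  | _ a ih =>
    choose! k hk using ih
    -- The sum bounds the levels of all successors at once; empty levels stay empty, so overshooting
    -- is harmless.
    refine ⟨((next a).map k).sum + 1, List.eq_nil_iff_forall_not_mem.2 fun b hb => ?_⟩
    obtain ⟨c, hc, hb⟩ := mem_reachLevel_succ.1 hb
    rw [reachLevel_eq_nil_of_le (List.single_le_sum (by simp) _ (List.mem_map_of_mem hc))
      (hk c hc)] at hb
    simp at hb

/-- Reachability of a decidable property along a terminating, finitely branching, computable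
relation is decidable. -/
theorem computablePred_exists_reachable [Primcodable α] {next : α → List α} (hnext : Primrec next)
    (wf : WellFounded fun b a => b ∈ next a) {p : α → Prop} [DecidablePred p]
    (hp : PrimrecPred p) :
    ComputablePred fun a => ∃ b, ReflTransGen (fun a b => b ∈ next a) a b ∧ p b := by
  classical
  have hlev : Primrec fun q : α × ℕ => reachLevel next q.2 [q.1] :=
    (primrec_reachLevel hnext).comp Primrec.snd
      (Primrec.list_cons.comp Primrec.fst (Primrec.const []))
  have hnil : PrimrecPred fun q : α × ℕ => reachLevel next q.2 [q.1] = [] :=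
    (Primrec.eq.comp (Primrec.list_length.comp hlev) (Primrec.const 0)).of_eq fun q => by simp
  -- The first empty level is found by unbounded search, so the bound is computable; everything
  -- reachable occurs below it.
  have hK := Computable.find (P := fun a k => reachLevel next k [a] = [])
    hnil.computablePred (exists_reachLevel_eq_nil wf)
  have hC : Primrec fun q : α × ℕ => (List.range q.2).flatMap fun j => reachLevel next j [q.1] :=
    Primrec.list_flatMap (Primrec.list_range.comp Primrec.snd)
      (hlev.comp (Primrec.pair (Primrec.fst.comp Primrec.fst) Primrec.snd)).to₂
  have hE := ((PrimrecPred.exists_mem_list hp).comp hC).decide.to_comp.comp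
    (Computable.pair Computable.id hK)
  refine hE.computablePred.of_eq fun a => ?_
  simp only [id, List.mem_flatMap, List.mem_range, reflTransGen_iff_mem_reachLevel]
  constructor
  · rintro ⟨b, ⟨j, -, hj⟩, hb⟩
    exact ⟨b, ⟨j, hj⟩, hb⟩
  · rintro ⟨b, ⟨j, hj⟩, hb⟩
    refine ⟨b, ⟨j, ?_, hj⟩, hb⟩
    by_contra hlt
    rw [reachLevel_eq_nil_of_le (not_lt.1 hlt)
      (Nat.find_spec (exists_reachLevel_eq_nil wf a))] at hj
    simp at hj

end Computability

/-! ### Lcms, duality with the opposite monoid, induction on atoms. -/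

namespace MultifractionReduction

open Relation

section Lcm

variable {M : Type*} [Monoid M]

theorem isLeftLcm_iff_op {a b m : M} :
    IsLeftLcm a b m ↔ IsRightLcm (MulOpposite.op a) (MulOpposite.op b) (MulOpposite.op m) := by
  simp [IsLeftLcm, IsRightLcm, LeftDvd, RightDvd, MulOpposite.exists, ← MulOpposite.op_mul]

theorem isMonoidAtom_op {a : M} : IsMonoidAtom (MulOpposite.op a) ↔ IsMonoidAtom a := by
  simp only [IsMonoidAtom, MulOpposite.forall, ← MulOpposite.op_mul, MulOpposite.op_inj, ne_eq,
    MulOpposite.op_eq_one_iff]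
  exact and_congr_right fun _ =>
    ⟨fun h b c e => (h c b e).symm, fun h b c e => (h c b e).symm⟩

theorem IsGcdMonoid.op (hM : IsGcdMonoid M) : IsGcdMonoid Mᵐᵒᵖ where
  cancel := by have := hM.cancel; infer_instance
  eq_one_of_isUnit := by
    intro a ha
    exact MulOpposite.unop_injective (hM.eq_one_of_isUnit _ ha.unop)
  exists_leftGcd a b := by
    obtain ⟨d, hd⟩ := hM.exists_rightGcd a.unop b.unop
    refine ⟨MulOpposite.op d, ?_⟩
    revert hd
    induction a with | _ a => induction b with | _ b =>
    simp [IsLeftGcd, IsRightGcd, LeftDvd, RightDvd, MulOpposite.forall, MulOpposite.exists,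
      ← MulOpposite.op_mul]
  exists_rightGcd a b := by
    obtain ⟨d, hd⟩ := hM.exists_leftGcd a.unop b.unop
    refine ⟨MulOpposite.op d, ?_⟩
    revert hd
    induction a with | _ a => induction b with | _ b =>
    simp [IsLeftGcd, IsRightGcd, LeftDvd, RightDvd, MulOpposite.forall, MulOpposite.exists,
      ← MulOpposite.op_mul]

/-- The two arguments are exchanged because `a \ b` completes `a`, whereas `a / b` completes `b`. -/
theorem IsRightBasic.unop {a : Mᵐᵒᵖ} (h : IsRightBasic a) : IsLeftBasic a.unop := by
  induction h with
  | atom h => exact .atom (isMonoidAtom_op.1 h)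
  | under _ _ h ih₁ ih₂ =>
    refine .over ih₂ ih₁ (isLeftLcm_iff_op.2 ?_)
    obtain ⟨h₁, h₂, h₃⟩ := h
    exact ⟨h₂, h₁, fun c hb ha => h₃ c ha hb⟩

theorem IsRightLcm.symm {a b m : M} (h : IsRightLcm a b m) : IsRightLcm b a m :=
  ⟨h.2.1, h.1, fun c hb ha => h.2.2 c ha hb⟩

theorem IsGcdMonoid.eq_one_of_mul_eq_one (hM : IsGcdMonoid M) {a b : M} (h : a * b = 1) :
    a = 1 ∧ b = 1 := by
  have := hM.cancel
  have h' : b * a = 1 := by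
    apply mul_left_cancel (a := a)
    rw [← mul_assoc, h, one_mul, mul_one]
  exact ⟨hM.eq_one_of_isUnit a ⟨⟨a, b, h, h'⟩, rfl⟩, hM.eq_one_of_isUnit b ⟨⟨b, a, h', h⟩, rfl⟩⟩

theorem LeftDvd.antisymm (hM : IsGcdMonoid M) {a b : M} (h₁ : LeftDvd a b) (h₂ : LeftDvd b a) :
    a = b := by
  have := hM.cancel
  obtain ⟨x, rfl⟩ := h₁
  obtain ⟨y, hy⟩ := h₂
  rw [mul_assoc] at hy
  have := hM.eq_one_of_mul_eq_one (a := x) (b := y) (mul_left_cancel (a := a) (by rw [mul_one]; exact hy.symm))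
  rw [this.1, mul_one]

theorem IsRightLcm.unique (hM : IsGcdMonoid M) {a b m m' : M} (h : IsRightLcm a b m)
    (h' : IsRightLcm a b m') : m = m' :=
  LeftDvd.antisymm hM (h.2.2 _ h'.1 h'.2.1) (h'.2.2 _ h.1 h.2.1)

/-- Dividing a common multiple `a * a' = b * b'` on the right by the right-gcd `d` of `a'` and `b'`
gives the lcm. Indeed, for another common multiple `c`, the left-gcd of `a * a₁` and `c` is still a
common multiple; if `a * a₁` is this gcd times `r`, then `r * d` is a common right-divisor of `a'`
and `b'`, which forces `r = 1`. -/
theorem IsGcdMonoid.exists_rightLcm (hM : IsGcdMonoid M) {a b m : M} (ha : LeftDvd a m)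
    (hb : LeftDvd b m) : ∃ c, IsRightLcm a b (a * c) := by
  have := hM.cancel
  obtain ⟨a', rfl⟩ := ha
  obtain ⟨b', hb'⟩ := hb
  obtain ⟨d, ⟨a₁, rfl⟩, ⟨b₁, rfl⟩, hd⟩ := hM.exists_rightGcd a' b'
  have hab : a * a₁ = b * b₁ := by
    rw [← mul_assoc, ← mul_assoc] at hb'
    exact mul_right_cancel hb'
  refine ⟨a₁, ⟨a₁, rfl⟩, ⟨b₁, hab⟩, fun c hac hbc => ?_⟩
  obtain ⟨g, ⟨r, hr⟩, hgc, hg⟩ := hM.exists_leftGcd (a * a₁) c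
  obtain ⟨p, rfl⟩ := hg a ⟨a₁, rfl⟩ hac
  obtain ⟨q, hq⟩ := hg b ⟨b₁, hab⟩ hbc
  have hp : a₁ = p * r := by
    rw [mul_assoc] at hr
    exact mul_left_cancel hr
  have hq' : b₁ = q * r := by
    rw [hab, hq, mul_assoc] at hr
    exact mul_left_cancel hr
  obtain ⟨s, hs⟩ := hd (r * d) ⟨p, by rw [hp, mul_assoc]⟩ ⟨q, by rw [hq', mul_assoc]⟩
  have : s * r = 1 := mul_right_cancel (b := d) (by rw [one_mul, mul_assoc]; exact hs.symm)
  rw [hp, (hM.eq_one_of_mul_eq_one this).2, mul_one]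
  exact hgc

/-- The right-lcm of `x * y` and `a` is computed by first taking the right-lcm of `x` and `a`. -/
theorem IsRightLcm.mul (hM : IsGcdMonoid M) {x y a p r : M} (h₁ : IsRightLcm x a (x * p))
    (h₂ : IsRightLcm y p (y * r)) : IsRightLcm (x * y) a (x * y * r) := by
  have := hM.cancel
  refine ⟨⟨r, rfl⟩, ?_, ?_⟩
  · obtain ⟨q, hq⟩ := h₁.2.1
    obtain ⟨s, hs⟩ := h₂.2.1
    exact ⟨q * s, by rw [mul_assoc, hs, ← mul_assoc, hq, mul_assoc]⟩
  · rintro _ ⟨c, rfl⟩ ha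
    obtain ⟨e, he⟩ := h₁.2.2 _ ⟨y * c, by rw [mul_assoc]⟩ ha
    rw [mul_assoc, mul_assoc] at he
    obtain ⟨f, hf⟩ := h₂.2.2 (y * c) ⟨c, rfl⟩ ⟨e, mul_left_cancel he⟩
    exact ⟨f, by rw [mul_assoc, hf]; simp only [mul_assoc]⟩

/-- Companion of `IsRightLcm.mul`: once the first lcm is extracted, the next cell of the grid still
has a common multiple, so the computation never gets stuck. -/
theorem LeftDvd.of_mul_mul_of_isRightLcm (hM : IsGcdMonoid M) {x y a p c : M}
    (h : IsRightLcm x a (x * p)) (hxy : LeftDvd (x * y) (x * c)) (ha : LeftDvd a (x * c)) :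
    LeftDvd y c ∧ LeftDvd p c := by
  have := hM.cancel
  obtain ⟨d, hd⟩ := hxy
  obtain ⟨e, he⟩ := h.2.2 _ ⟨c, rfl⟩ ha
  rw [mul_assoc] at hd he
  exact ⟨⟨d, mul_left_cancel hd⟩, ⟨e, mul_left_cancel he⟩⟩

theorem StronglyNoetherian.op (h : StronglyNoetherian M) : StronglyNoetherian Mᵐᵒᵖ := by
  obtain ⟨l, h₁, h₂⟩ := h
  refine ⟨fun a => l a.unop, fun a ha => h₁ _ (by simpa using ha), fun a b ha hb hab => ?_⟩
  rw [add_comm]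
  exact h₂ b.unop a.unop (by simpa using hb) (by simpa using ha)
    (fun h => hab (MulOpposite.unop_injective (by simpa using h)))

/-- Strong noetherianity, with a length map that is defined everywhere and vanishes at `1`. -/
theorem StronglyNoetherian.exists_length (hM : IsGcdMonoid M) (h : StronglyNoetherian M) :
    ∃ l : M → ℕ, (∀ a, l a = 0 ↔ a = 1) ∧ ∀ a b, l a + l b ≤ l (a * b) := by
  classical
  obtain ⟨l, h₁, h₂⟩ := h
  refine ⟨fun a => if a = 1 then 0 else l a, fun a => ?_, fun a b => ?_⟩
  · by_cases ha : a = 1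
    · simp [ha]
    · simp [ha, (h₁ a ha).ne']
  · by_cases ha : a = 1
    · simp [ha]
    by_cases hb : b = 1
    · simp [hb]
    have hab : a * b ≠ 1 := fun h => ha (hM.eq_one_of_mul_eq_one h).1
    simpa [ha, hb, hab] using h₂ a b ha hb hab

/-- Strong induction on length: the two factors of a non-atom both have positive length, hence
smaller length than the product. -/
theorem StronglyNoetherian.atom_induction (hM : IsGcdMonoid M) (h : StronglyNoetherian M)
    {p : M → Prop} (atom : ∀ a, IsMonoidAtom a → p a)
    (mul : ∀ a b, a ≠ 1 → b ≠ 1 → p a → p b → p (a * b)) : ∀ a, a ≠ 1 → p a := by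
  obtain ⟨l, h₁, h₂⟩ := h.exists_length hM
  intro a
  induction hn : l a using Nat.strong_induction_on generalizing a with
  | _ n ih =>
    subst hn
    intro ha
    by_cases hat : IsMonoidAtom a
    · exact atom a hat
    · simp only [IsMonoidAtom, not_and, not_forall, not_or] at hat
      obtain ⟨b, c, rfl, hb, hc⟩ := hat ha
      have hlt := h₂ b c
      have hb' := mt (h₁ b).1 hb
      have hc' := mt (h₁ c).1 hc
      exact mul b c hb hc (ih _ (by omega) b rfl hb) (ih _ (by omega) c rfl hc)

end Lcm

end MultifractionReduction

/-! ### Computing complements of words from a finite table. -/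

namespace MultifractionReduction

section Complement

variable {M : Type*} [Monoid M]

/-- The partial operation `c` on codes computes the right-complement of the encoded elements. -/
structure IsRightComplement {W : Type*} (ev : W → M) (c : W → W → Option W) : Prop where
  isRightLcm {u v w : W} : c u v = some w → IsRightLcm (ev u) (ev v) (ev u * ev w)
  exists_eq_some {u v : W} {m : M} :
    LeftDvd (ev u) m → LeftDvd (ev v) m → ∃ w, c u v = some w

/-- The partial operation `c` on codes computes the left-complement of the encoded elements. -/
structure IsLeftComplement {W : Type*} (ev : W → M) (c : W → W → Option W) : Prop where
  isLeftLcm {u v w : W} : c u v = some w → IsLeftLcm (ev u) (ev v) (ev w * ev u)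
  exists_eq_some {u v : W} {m : M} :
    RightDvd (ev u) m → RightDvd (ev v) m → ∃ w, c u v = some w

variable {X : Type*}

/-- The element represented by a word. -/
def wordEval (e : X → M) (w : List X) : M := (w.map e).prod

@[simp] theorem wordEval_nil (e : X → M) : wordEval e [] = 1 := rfl

@[simp] theorem wordEval_append (e : X → M) (u v : List X) :
    wordEval e (u ++ v) = wordEval e u * wordEval e v := by simp [wordEval]

@[simp] theorem wordEval_singleton (e : X → M) (a : X) : wordEval e [a] = e a := by
  simp [wordEval]

/-- Right-complements between a letter and a word: the result consists of the complement of the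
letter by the word and of the complement of the word by the letter. -/
def letterComplement (T : X → X → Option X) (a : X) (v : List X) : Option (X × List X) :=
  v.foldl (fun o b => o.bind fun p => (T p.1 b).bind fun d => (T b p.1).map fun a' =>
    (a', p.2 ++ [d])) (some (a, []))

/-- The right-complement on words deduced from a right-complement on letters whose values are
letters. -/
def wordComplement (T : X → X → Option X) (u v : List X) : Option (List X) :=
  u.foldl (fun o a => o.bind fun v => (letterComplement T a v).map Prod.snd) (some v)

theorem primrec_wordComplement [Primcodable X] {T : X → X → Option X} (hT : Primrec₂ T) :
    Primrec₂ (wordComplement T) := by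
  have h : Primrec₂ (letterComplement T) := by
    refine Primrec.list_foldl (f := fun q : X × List X => q.2)
      (g := fun q : X × List X => some (q.1, ([] : List X)))
      (h := fun _ (r : Option (X × List X) × X) => r.1.bind fun p =>
        (T p.1 r.2).bind fun d => (T r.2 p.1).map fun a' => (a', p.2 ++ [d]))
      Primrec.snd (Primrec.option_some.comp (Primrec.pair Primrec.fst (Primrec.const []))) ?_
    refine Primrec.option_bind (Primrec.fst.comp Primrec.snd) ?_
    refine Primrec.option_bind
      (hT.comp (Primrec.fst.comp Primrec.snd)
        (Primrec.snd.comp (Primrec.snd.comp Primrec.fst))) ?_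
    refine Primrec.option_map
      (hT.comp (Primrec.snd.comp (Primrec.snd.comp (Primrec.fst.comp Primrec.fst)))
        (Primrec.fst.comp (Primrec.snd.comp Primrec.fst))) ?_
    exact Primrec.pair Primrec.snd
      (Primrec.list_append.comp
        (Primrec.snd.comp (Primrec.snd.comp (Primrec.fst.comp Primrec.fst)))
        (Primrec.list_cons.comp (Primrec.snd.comp Primrec.fst) (Primrec.const [])))
  refine Primrec.list_foldl (f := fun q : List X × List X => q.1)
    (g := fun q : List X × List X => some q.2)
    (h := fun _ (r : Option (List X) × X) =>
      r.1.bind fun v => (letterComplement T r.2 v).map Prod.snd)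
    Primrec.fst (Primrec.option_some.comp Primrec.snd) ?_
  refine Primrec.option_bind (Primrec.fst.comp Primrec.snd) ?_
  exact Primrec.option_map
    (h.comp (Primrec.snd.comp (Primrec.snd.comp Primrec.fst)) Primrec.snd)
    (Primrec.snd.comp Primrec.snd)

variable {e : X → M} {T : X → X → Option X}

theorem letterComplement_append (a b : X) (v : List X) :
    letterComplement T a (v ++ [b]) = (letterComplement T a v).bind fun p =>
      (T p.1 b).bind fun d => (T b p.1).map fun a' => (a', p.2 ++ [d]) := by
  simp [letterComplement]

theorem wordComplement_append (u : List X) (a : X) (v : List X) :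
    wordComplement T (u ++ [a]) v = (wordComplement T u v).bind fun v =>
      (letterComplement T a v).map Prod.snd := by
  simp [wordComplement]

theorem isRightLcm_one (a : M) : IsRightLcm a 1 (a * 1) :=
  ⟨⟨1, rfl⟩, ⟨a, by simp⟩, fun _ h _ => by rwa [mul_one]⟩

/-- A row of the grid is a commuting rectangle with sides `a`, `w` and `v`, `a'`; keeping the final
letter `a'` is what allows the next letter of `v` to be appended. -/
theorem letterComplement_eq_some (hM : IsGcdMonoid M) (hT : IsRightComplement e T) {a a' : X}
    {v w : List X} (h : letterComplement T a v = some (a', w)) :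
    IsRightLcm (e a) (wordEval e v) (e a * wordEval e w) ∧
      e a * wordEval e w = wordEval e v * e a' := by
  induction v using List.reverseRecOn generalizing a' w with
  | nil =>
    obtain ⟨rfl, rfl⟩ : a = a' ∧ [] = w := by simpa [letterComplement] using h
    exact ⟨isRightLcm_one _, by simp⟩
  | append_singleton v b ih =>
    rw [letterComplement_append] at h
    obtain ⟨⟨c, w'⟩, hc, h⟩ := Option.bind_eq_some_iff.1 h
    obtain ⟨d, hd, h⟩ := Option.bind_eq_some_iff.1 h
    obtain ⟨c', hc', h⟩ := Option.map_eq_some_iff.1 h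
    obtain ⟨rfl, rfl⟩ : c' = a' ∧ w' ++ [d] = w := by simpa using h
    obtain ⟨h₁, h₂⟩ := ih hc
    have h₃ := hT.isRightLcm hc'
    have h₄ := h₃.unique hM (hT.isRightLcm hd).symm
    have h₅ := IsRightLcm.mul hM (h₂ ▸ h₁.symm) h₃
    have h₆ : e a * wordEval e (w' ++ [d]) = wordEval e (v ++ [b]) * e c' := by
      simp only [wordEval_append, wordEval_singleton]
      rw [← mul_assoc, h₂, mul_assoc, ← h₄, mul_assoc]
    exact ⟨by rw [h₆]; simpa using h₅.symm, h₆⟩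

theorem exists_letterComplement_eq_some (hM : IsGcdMonoid M) (hT : IsRightComplement e T) {a : X}
    {v : List X} {m : M} (h₁ : LeftDvd (e a) m) (h₂ : LeftDvd (wordEval e v) m) :
    ∃ p, letterComplement T a v = some p := by
  induction v using List.reverseRecOn with
  | nil => exact ⟨_, rfl⟩
  | append_singleton v b ih =>
    rw [letterComplement_append]
    rw [wordEval_append, wordEval_singleton] at h₂
    have hv : LeftDvd (wordEval e v) m := by
      obtain ⟨x, rfl⟩ := h₂
      exact ⟨e b * x, by rw [mul_assoc]⟩
    obtain ⟨⟨c, w⟩, hc⟩ := ih hv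
    obtain ⟨h₃, h₄⟩ := letterComplement_eq_some hM hT hc
    obtain ⟨m, rfl⟩ := hv
    obtain ⟨h₅, h₆⟩ := LeftDvd.of_mul_mul_of_isRightLcm hM (h₄ ▸ h₃.symm) h₂ h₁
    obtain ⟨d, hd⟩ := hT.exists_eq_some h₆ h₅
    obtain ⟨c', hc'⟩ := hT.exists_eq_some h₅ h₆
    exact ⟨(c', w ++ [d]), by simp [hc, hd, hc']⟩

theorem wordComplement_eq_some (hM : IsGcdMonoid M) (hT : IsRightComplement e T) {u v w : List X}
    (h : wordComplement T u v = some w) :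
    IsRightLcm (wordEval e u) (wordEval e v) (wordEval e u * wordEval e w) := by
  induction u using List.reverseRecOn generalizing w with
  | nil =>
    obtain rfl : v = w := by simpa [wordComplement] using h
    simpa using (isRightLcm_one (wordEval e v)).symm
  | append_singleton u a ih =>
    rw [wordComplement_append] at h
    obtain ⟨p, hp, h⟩ := Option.bind_eq_some_iff.1 h
    obtain ⟨⟨a', w'⟩, hw, h⟩ := Option.map_eq_some_iff.1 h
    obtain rfl : w' = w := h
    simpa using IsRightLcm.mul hM (ih hp) (letterComplement_eq_some hM hT hw).1

theorem isRightComplement_wordComplement (hM : IsGcdMonoid M) (hT : IsRightComplement e T) :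
    IsRightComplement (wordEval e) (wordComplement T) where
  isRightLcm := wordComplement_eq_some hM hT
  exists_eq_some {u v m} h₁ h₂ := by
    induction u using List.reverseRecOn with
    | nil => exact ⟨v, rfl⟩
    | append_singleton u a ih =>
      rw [wordComplement_append]
      rw [wordEval_append, wordEval_singleton] at h₁
      have hu : LeftDvd (wordEval e u) m := by
        obtain ⟨x, rfl⟩ := h₁
        exact ⟨e a * x, by rw [mul_assoc]⟩
      obtain ⟨p, hp⟩ := ih hu
      obtain ⟨m, rfl⟩ := hu
      obtain ⟨h₅, h₆⟩ := LeftDvd.of_mul_mul_of_isRightLcm hM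
        (wordComplement_eq_some hM hT hp) h₁ h₂
      obtain ⟨q, hq⟩ := exists_letterComplement_eq_some hM hT h₅ h₆
      exact ⟨q.2, by simp [hp, hq]⟩

/-- Every element is represented by a word in the atoms. -/
theorem exists_wordEval_eq (hM : IsGcdMonoid M) (hn : StronglyNoetherian M) {s : X → M}
    (hs : ∀ a, IsMonoidAtom a → ∃ j, s j = a) (a : M) : ∃ w, wordEval s w = a := by
  by_cases ha : a = 1
  · exact ⟨[], ha.symm⟩
  refine hn.atom_induction hM (p := fun a => ∃ w, wordEval s w = a) ?_ ?_ a ha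
  · intro a ha
    obtain ⟨j, rfl⟩ := hs a ha
    exact ⟨[j], by simp⟩
  · rintro _ _ - - ⟨u, rfl⟩ ⟨v, rfl⟩
    exact ⟨u ++ v, by simp⟩

/-- If there are finitely many right-basic elements, the right-complement is primitive recursive
on words in the atoms. -/
theorem exists_primrec_isRightComplement (hM : IsGcdMonoid M) (hn : StronglyNoetherian M)
    (hb : {a : M | IsRightBasic a}.Finite) {n : ℕ} {s : Fin n → M}
    (hs : ∀ a, IsMonoidAtom a ↔ ∃ j, s j = a) :
    ∃ c : List (Fin n) → List (Fin n) → Option (List (Fin n)),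
      Primrec₂ c ∧ IsRightComplement (wordEval s) c := by
  classical
  have : Finite {a : M | IsRightBasic a} := hb
  obtain ⟨N, ⟨i⟩⟩ := Finite.exists_equiv_fin {a : M | IsRightBasic a}
  let e : Fin N → M := fun x => (i.symm x : M)
  have he (x : Fin N) : IsRightBasic (e x) := (i.symm x).2
  have he' {a : M} (ha : IsRightBasic a) : ∃ x, e x = a := ⟨i ⟨a, ha⟩, by simp [e]⟩
  -- The complement of two right-basic elements is right-basic, so the table takes values in letters
  -- again.
  let T : Fin N → Fin N → Option (Fin N) := fun a b =>
    if h : ∃ d, IsRightLcm (e a) (e b) (e a * e d) then some h.choose else none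
  have hT : IsRightComplement e T :=
    { isRightLcm := by
        intro u v w h
        simp only [T] at h
        split_ifs at h with h'
        obtain rfl := Option.some.inj h
        exact h'.choose_spec
      exists_eq_some := by
        intro u v m h₁ h₂
        obtain ⟨d, hd⟩ := hM.exists_rightLcm h₁ h₂
        obtain ⟨x, rfl⟩ := he' (.under (he u) (he v) hd)
        exact ⟨_, dif_pos ⟨x, hd⟩⟩ }
  have hc := isRightComplement_wordComplement hM hT
  -- Atoms are translated into basic letters, and basic letters back into words in the atoms. As
  -- finite tables, `φ`, `ψ` and `T` are automatically primitive recursive.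
  choose φ hφ using fun j => he' (.atom ((hs (s j)).2 ⟨j, rfl⟩))
  choose ψ hψ using fun x => exists_wordEval_eq hM hn (fun a ha => (hs a).1 ha) (e x)
  have hφ' (w : List (Fin n)) : wordEval e (w.map φ) = wordEval s w := by
    simp [wordEval, Function.comp_def, hφ]
  have hψ' (w : List (Fin N)) : wordEval s (w.flatMap ψ) = wordEval e w := by
    induction w with
    | nil => rfl
    | cons x w ih =>
      rw [List.flatMap_cons, wordEval_append, ih, hψ]
      simp [wordEval]
  refine ⟨fun u v => (wordComplement T (u.map φ) (v.map φ)).map (List.flatMap ψ), ?_, ?_, ?_⟩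
  · have hT' : Primrec₂ T := Primrec.dom_finite _
    have hmap : Primrec fun w : List (Fin n) => w.map φ :=
      Primrec.list_map Primrec.id ((Primrec.dom_finite φ).comp Primrec.snd).to₂
    have hflat : Primrec fun w : List (Fin N) => w.flatMap ψ :=
      Primrec.list_flatMap Primrec.id ((Primrec.dom_finite ψ).comp Primrec.snd).to₂
    exact Primrec.option_map ((primrec_wordComplement hT').comp (hmap.comp Primrec.fst)
      (hmap.comp Primrec.snd)) (hflat.comp Primrec.snd).to₂
  · intro u v w h
    obtain ⟨w, hw, rfl⟩ := Option.map_eq_some_iff.1 h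
    simpa only [hφ', hψ'] using hc.isRightLcm hw
  · intro u v m h₁ h₂
    rw [← hφ'] at h₁ h₂
    obtain ⟨w, hw⟩ := hc.exists_eq_some h₁ h₂
    exact ⟨_, by rw [hw]; rfl⟩

/-- Reversing words realizes the passage to the opposite monoid, so conjugating a right-complement
by reversal yields a left-complement. -/
theorem wordEval_op_reverse (s : X → M) (w : List X) :
    wordEval (fun j => MulOpposite.op (s j)) w.reverse = MulOpposite.op (wordEval s w) := by
  simp [wordEval, MulOpposite.op_list_prod, Function.comp_def]

theorem exists_primrec_isLeftComplement (hM : IsGcdMonoid M) (hn : StronglyNoetherian M)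
    (hb : {a : M | IsLeftBasic a}.Finite) {n : ℕ} {s : Fin n → M}
    (hs : ∀ a, IsMonoidAtom a ↔ ∃ j, s j = a) :
    ∃ c : List (Fin n) → List (Fin n) → Option (List (Fin n)),
      Primrec₂ c ∧ IsLeftComplement (wordEval s) c := by
  have hb' : {a : Mᵐᵒᵖ | IsRightBasic a}.Finite :=
    (hb.preimage MulOpposite.unop_injective.injOn).subset fun a ha => IsRightBasic.unop ha
  have hs' (a : Mᵐᵒᵖ) : IsMonoidAtom a ↔ ∃ j, MulOpposite.op (s j) = a := by
    induction a with | _ a =>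
    simp [isMonoidAtom_op, hs]
  obtain ⟨c, hc, h⟩ := exists_primrec_isRightComplement hM.op hn.op hb' hs'
  refine ⟨fun u v => (c u.reverse v.reverse).map List.reverse, ?_, ?_, ?_⟩
  · exact Primrec.option_map (hc.comp (Primrec.list_reverse.comp Primrec.fst)
      (Primrec.list_reverse.comp Primrec.snd)) (Primrec.list_reverse.comp Primrec.snd).to₂
  · intro u v w hw
    obtain ⟨w, hw', rfl⟩ := Option.map_eq_some_iff.1 hw
    have := h.isRightLcm hw'
    rw [wordEval_op_reverse, wordEval_op_reverse, ← List.reverse_reverse w, wordEval_op_reverse,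
      ← MulOpposite.op_mul] at this
    exact isLeftLcm_iff_op.2 this
  · rintro u v m ⟨x, hx⟩ ⟨y, hy⟩
    obtain ⟨w, hw⟩ := h.exists_eq_some (u := u.reverse) (v := v.reverse) (m := MulOpposite.op m)
      ⟨MulOpposite.op x, by rw [wordEval_op_reverse, hx, MulOpposite.op_mul]⟩
      ⟨MulOpposite.op y, by rw [wordEval_op_reverse, hy, MulOpposite.op_mul]⟩
    exact ⟨_, by rw [hw]; rfl⟩

end Complement

end MultifractionReduction

/-! ### Elementary reductions on sequences of words. -/

namespace MultifractionReduction

open Relation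

section WordReduction

variable {M : Type*} [Monoid M] {X : Type*}

/-- No exchange of arguments occurs: in `IsLeftComplement` the first argument is the one being
completed. -/
theorem IsLeftComplement.op {W : Type*} {ev : W → M} {c : W → W → Option W}
    (h : IsLeftComplement ev c) : IsRightComplement (fun w => MulOpposite.op (ev w)) c where
  isRightLcm hw := isLeftLcm_iff_op.1 (h.isLeftLcm hw)
  exists_eq_some {u v m} := by
    rintro ⟨x, hx⟩ ⟨y, hy⟩
    exact h.exists_eq_some (m := m.unop) ⟨x.unop, by rw [hx]; rfl⟩ ⟨y.unop, by rw [hy]; rfl⟩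

/-- Division of the word `a` by the letter `x`, deduced from a complement operation `c`. -/
def wordDiv [DecidableEq X] (c : List X → List X → Option (List X)) (x : X) (a : List X) :
    Option (List X) :=
  (c a [x]).bind fun w => if w = [] then c [x] a else none

/-- The entries `x'`, `b₂`, `b₃` that result from reducing `a₁ / a₂ / a₃` by `x`. -/
def wordReduce [DecidableEq X] (c : List X → List X → Option (List X)) (x : X) (a₂ a₃ : List X) :
    Option (List X × List X × List X) :=
  (c a₂ [x]).bind fun x' => (c [x] a₂).bind fun b₂ => (wordDiv c x a₃).map fun b₃ => (x', b₂, b₃)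

section Spec

variable [DecidableEq X] {ev : List X → M} {c : List X → List X → Option (List X)}

/-- An empty complement of `a` by `x` says that the lcm is `a` itself, that is, `x` divides `a`; the
other complement is then the quotient. -/
theorem wordDiv_eq_some (hM : IsGcdMonoid M) (hc : IsRightComplement ev c) (h₁ : ev [] = 1)
    {x : X} {a b : List X} (h : wordDiv c x a = some b) : ev [x] * ev b = ev a := by
  obtain ⟨w, hw, h⟩ := Option.bind_eq_some_iff.1 h
  split_ifs at h with hnil
  subst hnil
  have := (hc.isRightLcm h).unique hM (hc.isRightLcm hw).symm
  rwa [h₁, mul_one] at this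

/-- Testing for the empty word detects divisibility because no other word represents `1`. -/
theorem exists_wordDiv_eq_some (hM : IsGcdMonoid M) (hc : IsRightComplement ev c)
    (h₁ : ∀ w, ev w = 1 → w = []) {x : X} {a : List X} {m : M} (h : ev [x] * m = ev a) :
    ∃ b, wordDiv c x a = some b ∧ ev b = m := by
  have := hM.cancel
  have hx : LeftDvd (ev [x]) (ev a) := ⟨m, h.symm⟩
  have ha : LeftDvd (ev a) (ev a) := ⟨1, (mul_one _).symm⟩
  obtain ⟨w, hw⟩ := hc.exists_eq_some ha hx
  obtain ⟨b, hb⟩ := hc.exists_eq_some hx ha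
  have hlcm : IsRightLcm (ev [x]) (ev a) (ev a) := ⟨hx, ha, fun _ _ h => h⟩
  have hw₁ : ev w = 1 := mul_left_cancel (a := ev a)
    (by rw [mul_one]; exact (hc.isRightLcm hw).symm.unique hM hlcm)
  obtain rfl := h₁ w hw₁
  refine ⟨b, by simp [wordDiv, hw, hb], mul_left_cancel (a := ev [x]) ?_⟩
  rw [h]
  exact (hc.isRightLcm hb).unique hM hlcm

/-- The evaluation `ev` is arbitrary so that the same result serves for even levels in `M` and for
odd levels in the opposite monoid. -/
theorem wordReduce_eq_some (hM : IsGcdMonoid M) (hc : IsRightComplement ev c) (h₁ : ev [] = 1)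
    {x : X} {a₂ a₃ x' b₂ b₃ : List X} (h : wordReduce c x a₂ a₃ = some (x', b₂, b₃)) :
    ev [x] * ev b₂ = ev a₂ * ev x' ∧ IsRightLcm (ev [x]) (ev a₂) (ev a₂ * ev x') ∧
      ev [x] * ev b₃ = ev a₃ := by
  obtain ⟨y, hy, h⟩ := Option.bind_eq_some_iff.1 h
  obtain ⟨z, hz, h⟩ := Option.bind_eq_some_iff.1 h
  obtain ⟨d, hd, h⟩ := Option.map_eq_some_iff.1 h
  obtain ⟨rfl, rfl, rfl⟩ : y = x' ∧ z = b₂ ∧ d = b₃ := by simpa using h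
  have := (hc.isRightLcm hy).symm
  exact ⟨(hc.isRightLcm hz).unique hM this, this, wordDiv_eq_some hM hc h₁ hd⟩

theorem exists_wordReduce_eq_some (hM : IsGcdMonoid M) (hc : IsRightComplement ev c)
    (h₁ : ∀ w, ev w = 1 → w = []) {x : X} {a₂ a₃ : List X} {x' b₂ b₃ : M}
    (h₂ : ev [x] * b₂ = ev a₂ * x') (hl : IsRightLcm (ev [x]) (ev a₂) (ev a₂ * x'))
    (h₃ : ev [x] * b₃ = ev a₃) : ∃ u v w, wordReduce c x a₂ a₃ = some (u, v, w) ∧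
      ev u = x' ∧ ev v = b₂ ∧ ev w = b₃ := by
  have := hM.cancel
  obtain ⟨u, hu⟩ := hc.exists_eq_some hl.2.1 hl.1
  obtain ⟨v, hv⟩ := hc.exists_eq_some hl.1 hl.2.1
  obtain ⟨w, hw, rfl⟩ := exists_wordDiv_eq_some hM hc h₁ h₃
  refine ⟨u, v, w, by simp [wordReduce, hu, hv, hw], mul_left_cancel (a := ev a₂) ?_,
    mul_left_cancel (a := ev [x]) ?_, rfl⟩
  · exact (hc.isRightLcm hu).symm.unique hM hl
  · rw [h₂]
    exact (hc.isRightLcm hv).unique hM hl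

end Spec

/-- Reduction of the first three entries, at the level of words. -/
def headReduce [DecidableEq X] (c : List X → List X → Option (List X))
    (join : List X → List X → List X) (x : X) (t : List (List X)) : Option (List (List X)) :=
  if 3 ≤ t.length then
    (wordReduce c x (t.getD 1 []) (t.getD 2 [])).map fun p =>
      join (t.getD 0 []) p.1 :: p.2.1 :: p.2.2 :: t.drop 3
  else none

/-- Simplification of the first two entries, at the level of words. -/
def headSimplify [DecidableEq X] (c : List X → List X → Option (List X)) (x : X)
    (t : List (List X)) : Option (List (List X)) :=
  if 2 ≤ t.length then
    (wordDiv c x (t.getD 0 [])).bind fun b₁ =>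
      (wordDiv c x (t.getD 1 [])).map fun b₂ => b₁ :: b₂ :: t.drop 2
  else none

/-- The length guard ensures that the default entries of `getD` are never used. -/
theorem headReduce_eq_some [DecidableEq X] {c : List X → List X → Option (List X)}
    {join : List X → List X → List X} {x : X} {t r : List (List X)}
    (h : headReduce c join x t = some r) : ∃ a₁ a₂ a₃ x' b₂ b₃ v, t = a₁ :: a₂ :: a₃ :: v ∧
      r = join a₁ x' :: b₂ :: b₃ :: v ∧ wordReduce c x a₂ a₃ = some (x', b₂, b₃) := by
  match t with
  | [] => simp [headReduce] at h
  | [_] => simp [headReduce] at h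
  | [_, _] => simp [headReduce] at h
  | a₁ :: a₂ :: a₃ :: v =>
    obtain ⟨x', b₂, b₃, h', rfl⟩ : ∃ x' b₂ b₃, wordReduce c x a₂ a₃ = some (x', b₂, b₃) ∧
      join a₁ x' :: b₂ :: b₃ :: v = r := by simpa [headReduce] using h
    exact ⟨a₁, a₂, a₃, x', b₂, b₃, v, rfl, rfl, h'⟩

theorem headSimplify_eq_some [DecidableEq X] {c : List X → List X → Option (List X)}
    {x : X} {t r : List (List X)} (h : headSimplify c x t = some r) :
    ∃ a₁ a₂ b₁ b₂ v, t = a₁ :: a₂ :: v ∧ r = b₁ :: b₂ :: v ∧ wordDiv c x a₁ = some b₁ ∧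
      wordDiv c x a₂ = some b₂ := by
  match t with
  | [] => simp [headSimplify] at h
  | [_] => simp [headSimplify] at h
  | a₁ :: a₂ :: v =>
    obtain ⟨b₁, h₁, b₂, h₂, rfl⟩ : ∃ b₁, wordDiv c x a₁ = some b₁ ∧ ∃ b₂,
      wordDiv c x a₂ = some b₂ ∧ b₁ :: b₂ :: v = r := by
      simpa [headSimplify, Option.bind_eq_some_iff] using h
    exact ⟨a₁, a₂, b₁, b₂, v, rfl, rfl, h₁, h₂⟩

/-- The lists obtained by rewriting a suffix, using `H₀` or `H₁` according to whether it starts at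
an even or an odd position; the second component exchanges the roles. -/
def alternatingRewrites {β : Type*} (H₀ H₁ : List β → List (List β)) :
    List β → List (List β) × List (List β)
  | [] => ([], [])
  | a :: l => (H₀ (a :: l) ++ (alternatingRewrites H₀ H₁ l).2.map (List.cons a),
      H₁ (a :: l) ++ (alternatingRewrites H₀ H₁ l).1.map (List.cons a))

/-- Both components are treated together, since removing the first entry flips the parity of
positions. A prefix `u` corresponds to level `u.length + 2`, which has the same parity as
`u.length`. -/
theorem of_mem_alternatingRewrites {β : Type*} {H₀ H₁ : List β → List (List β)} {l r : List β} :
    (r ∈ (alternatingRewrites H₀ H₁ l).1 → ∃ u t t', l = u ++ t ∧ r = u ++ t' ∧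
      ((Even u.length ∧ t' ∈ H₀ t) ∨ (Odd u.length ∧ t' ∈ H₁ t))) ∧
    (r ∈ (alternatingRewrites H₀ H₁ l).2 → ∃ u t t', l = u ++ t ∧ r = u ++ t' ∧
      ((Even u.length ∧ t' ∈ H₁ t) ∨ (Odd u.length ∧ t' ∈ H₀ t))) := by
  induction l generalizing r with
  | nil => simp [alternatingRewrites]
  | cons a l ih =>
    simp only [alternatingRewrites, List.mem_append, List.mem_map]
    constructor
    · rintro (h | ⟨r, h, rfl⟩)
      · exact ⟨[], _, _, rfl, rfl, .inl ⟨by simp, h⟩⟩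
      · obtain ⟨u, t, t', rfl, rfl, h'⟩ := ih.2 h
        clear h
        refine ⟨a :: u, t, t', rfl, rfl, ?_⟩
        rcases h' with ⟨h, h'⟩ | ⟨h, h'⟩
        · exact .inr ⟨by simpa using h.add_one, h'⟩
        · exact .inl ⟨by simpa using h.add_one, h'⟩
    · rintro (h | ⟨r, h, rfl⟩)
      · exact ⟨[], _, _, rfl, rfl, .inl ⟨by simp, h⟩⟩
      · obtain ⟨u, t, t', rfl, rfl, h'⟩ := ih.1 h
        clear h
        refine ⟨a :: u, t, t', rfl, rfl, ?_⟩
        rcases h' with ⟨h, h'⟩ | ⟨h, h'⟩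
        · exact .inr ⟨by simpa using h.add_one, h'⟩
        · exact .inl ⟨by simpa using h.add_one, h'⟩

theorem mem_alternatingRewrites {β : Type*} {H₀ H₁ : List β → List (List β)} {u t t' : List β}
    (ht : t ≠ []) :
    (Even u.length ∧ t' ∈ H₀ t ∨ Odd u.length ∧ t' ∈ H₁ t →
      u ++ t' ∈ (alternatingRewrites H₀ H₁ (u ++ t)).1) ∧
    (Even u.length ∧ t' ∈ H₁ t ∨ Odd u.length ∧ t' ∈ H₀ t →
      u ++ t' ∈ (alternatingRewrites H₀ H₁ (u ++ t)).2) := by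
  induction u with
  | nil =>
    obtain ⟨b, l, rfl⟩ := List.exists_cons_of_ne_nil ht
    simp +contextual [alternatingRewrites]
  | cons a u ih =>
    simp only [List.cons_append, alternatingRewrites, List.mem_append, List.length_cons,
      Nat.even_add_one, Nat.odd_add_one, Nat.not_even_iff_odd, Nat.not_odd_iff_even]
    exact ⟨fun h => .inr (List.mem_map_of_mem (ih.2 h.symm)),
      fun h => .inr (List.mem_map_of_mem (ih.1 h.symm))⟩

section Primrec

variable [Primcodable X] [DecidableEq X] {c : List X → List X → Option (List X)}

theorem primrec_wordDiv (hc : Primrec₂ c) : Primrec₂ (wordDiv c) := by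
  have hx : Primrec fun x : X => [x] := Primrec.list_cons.comp Primrec.id (Primrec.const [])
  refine Primrec.option_bind (hc.comp Primrec.snd (hx.comp Primrec.fst)) ?_
  refine Primrec.ite ?_ (hc.comp (hx.comp (Primrec.fst.comp Primrec.fst))
    (Primrec.snd.comp Primrec.fst)) (Primrec.const none)
  exact (Primrec.eq.comp (Primrec.list_length.comp Primrec.snd) (Primrec.const 0)).of_eq
    fun q => by simp

theorem primrec_wordReduce (hc : Primrec₂ c) :
    Primrec fun q : X × List X × List X => wordReduce c q.1 q.2.1 q.2.2 := by
  have hx : Primrec fun x : X => [x] := Primrec.list_cons.comp Primrec.id (Primrec.const [])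
  refine Primrec.option_bind (hc.comp (Primrec.fst.comp Primrec.snd) (hx.comp Primrec.fst)) ?_
  refine Primrec.option_bind (hc.comp (hx.comp (Primrec.fst.comp Primrec.fst))
    (Primrec.fst.comp (Primrec.snd.comp Primrec.fst))) ?_
  refine Primrec.option_map ((primrec_wordDiv hc).comp
    (Primrec.fst.comp (Primrec.fst.comp Primrec.fst))
    (Primrec.snd.comp (Primrec.snd.comp (Primrec.fst.comp Primrec.fst)))) ?_
  exact Primrec.pair (Primrec.snd.comp (Primrec.fst.comp Primrec.fst))
    (Primrec.pair (Primrec.snd.comp Primrec.fst) Primrec.snd)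

theorem primrec_headReduce (hc : Primrec₂ c) {join : List X → List X → List X}
    (hj : Primrec₂ join) : Primrec₂ (headReduce c join) := by
  have hget (i : ℕ) : Primrec fun q : X × List (List X) => q.2.getD i [] :=
    (Primrec.list_getD []).comp Primrec.snd (Primrec.const i)
  refine Primrec.ite
    (Primrec.nat_le.comp (Primrec.const 3) (Primrec.list_length.comp Primrec.snd)) ?_
    (Primrec.const none)
  refine Primrec.option_map ((primrec_wordReduce hc).comp
    (Primrec.pair Primrec.fst (Primrec.pair (hget 1) (hget 2)))) ?_
  exact Primrec.list_cons.comp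
    (hj.comp ((hget 0).comp Primrec.fst) (Primrec.fst.comp Primrec.snd))
    (Primrec.list_cons.comp (Primrec.fst.comp (Primrec.snd.comp Primrec.snd))
      (Primrec.list_cons.comp (Primrec.snd.comp (Primrec.snd.comp Primrec.snd))
        (Primrec.list_drop.comp (Primrec.const 3) (Primrec.snd.comp Primrec.fst))))

theorem primrec_headSimplify (hc : Primrec₂ c) : Primrec₂ (headSimplify c) := by
  have hget (i : ℕ) : Primrec fun q : X × List (List X) => q.2.getD i [] :=
    (Primrec.list_getD []).comp Primrec.snd (Primrec.const i)
  refine Primrec.ite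
    (Primrec.nat_le.comp (Primrec.const 2) (Primrec.list_length.comp Primrec.snd)) ?_
    (Primrec.const none)
  refine Primrec.option_bind ((primrec_wordDiv hc).comp Primrec.fst (hget 0)) ?_
  refine Primrec.option_map ((primrec_wordDiv hc).comp (Primrec.fst.comp Primrec.fst)
    ((hget 1).comp Primrec.fst)) ?_
  exact Primrec.list_cons.comp (Primrec.snd.comp Primrec.fst)
    (Primrec.list_cons.comp Primrec.snd
      (Primrec.list_drop.comp (Primrec.const 2)
        (Primrec.snd.comp (Primrec.fst.comp Primrec.fst))))

theorem primrec_alternatingRewrites {β : Type*} [Primcodable β] {H₀ H₁ : List β → List (List β)}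
    (h₀ : Primrec H₀) (h₁ : Primrec H₁) : Primrec (alternatingRewrites H₀ H₁) := by
  have hcons : Primrec fun q : List β × β × List β × List (List β) × List (List β) =>
      q.2.1 :: q.2.2.1 :=
    Primrec.list_cons.comp (Primrec.fst.comp Primrec.snd)
      (Primrec.fst.comp (Primrec.snd.comp Primrec.snd))
  have hmap {g : List (List β) × List (List β) → List (List β)} (hg : Primrec g) :
      Primrec fun q : List β × β × List β × List (List β) × List (List β) =>
        (g q.2.2.2).map (List.cons q.2.1) :=
    Primrec.list_map (hg.comp (Primrec.snd.comp (Primrec.snd.comp Primrec.snd)))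
      (Primrec.list_cons.comp (Primrec.fst.comp (Primrec.snd.comp Primrec.fst)) Primrec.snd).to₂
  refine (Primrec.list_rec (f := id) (g := fun _ => (([], []) : List (List β) × List (List β)))
    (h := fun _ q => (H₀ (q.1 :: q.2.1) ++ q.2.2.2.map (List.cons q.1),
      H₁ (q.1 :: q.2.1) ++ q.2.2.1.map (List.cons q.1)))
    Primrec.id (Primrec.const ([], [])) (Primrec.pair
      (Primrec.list_append.comp (h₀.comp hcons) (hmap Primrec.snd))
      (Primrec.list_append.comp (h₁.comp hcons) (hmap Primrec.fst))).to₂).of_eq fun l => ?_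
  induction l with
  | nil => rfl
  | cons a l ih => simp only [id, alternatingRewrites] at ih ⊢; rw [← ih]

end Primrec

/-- All results of the elementary reductions by letters, at the level of words. -/
def wordReducts {n : ℕ} (cr cl : List (Fin n) → List (Fin n) → Option (List (Fin n)))
    (t : List (List (Fin n))) : List (List (List (Fin n))) :=
  (alternatingRewrites
    (fun t => (List.finRange n).filterMap fun x => headReduce cr (fun a b => a ++ b) x t)
    (fun t => (List.finRange n).filterMap fun x => headReduce cl (fun a b => b ++ a) x t) t).1 ++
  (List.finRange n).filterMap fun x => headSimplify cl x t

theorem primrec_wordReducts {n : ℕ}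
    {cr cl : List (Fin n) → List (Fin n) → Option (List (Fin n))} (hr : Primrec₂ cr)
    (hl : Primrec₂ cl) : Primrec (wordReducts cr cl) := by
  have hf {g : Fin n → List (List (Fin n)) → Option (List (List (Fin n)))} (hg : Primrec₂ g) :
      Primrec fun t => (List.finRange n).filterMap fun x => g x t :=
    Primrec.listFilterMap (Primrec.const _) (hg.comp Primrec.snd Primrec.fst).to₂
  exact Primrec.list_append.comp
    (Primrec.fst.comp (primrec_alternatingRewrites
      (hf (primrec_headReduce hr Primrec.list_append))
      (hf (primrec_headReduce hl Primrec.list_append.swap))))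
    (hf (primrec_headSimplify hl))

variable {n : ℕ} {s : Fin n → M} {cr cl : List (Fin n) → List (Fin n) → Option (List (Fin n))}

theorem eq_nil_of_wordEval_eq_one (hM : IsGcdMonoid M) (hs : ∀ j, IsMonoidAtom (s j))
    {w : List (Fin n)} (h : wordEval s w = 1) : w = [] := by
  cases w with
  | nil => rfl
  | cons j w =>
    rw [← List.singleton_append, wordEval_append, wordEval_singleton] at h
    exact absurd (hM.eq_one_of_mul_eq_one h).1 (hs j).1

theorem redAt_of_mem_wordReducts (hM : IsGcdMonoid M) (hcr : IsRightComplement (wordEval s) cr)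
    (hcl : IsLeftComplement (wordEval s) cl) {t r : List (List (Fin n))}
    (h : r ∈ wordReducts cr cl t) :
    ∃ i j, RedAt i (s j) (t.map (wordEval s)) (r.map (wordEval s)) := by
  rw [wordReducts, List.mem_append] at h
  rcases h with h | h
  · obtain ⟨u, t, r, rfl, rfl, h'⟩ := of_mem_alternatingRewrites.1 h
    clear h
    rcases h' with ⟨hu, h⟩ | ⟨hu, h⟩
    · obtain ⟨j, -, h⟩ := List.mem_filterMap.1 h
      obtain ⟨a₁, a₂, a₃, x', b₂, b₃, v, rfl, rfl, h'⟩ := headReduce_eq_some h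
      obtain ⟨h₂, hl, h₃⟩ := wordReduce_eq_some hM hcr rfl h'
      rw [wordEval_singleton] at h₂ hl h₃
      refine ⟨(u.map (wordEval s)).length + 2, j, ?_⟩
      simp only [List.map_append, List.map_cons, wordEval_append]
      exact RedAt.even (by simpa using hu.add even_two) rfl h₂ hl h₃
    · obtain ⟨j, -, h⟩ := List.mem_filterMap.1 h
      obtain ⟨a₁, a₂, a₃, x', b₂, b₃, v, rfl, rfl, h'⟩ := headReduce_eq_some h
      obtain ⟨h₂, hl, h₃⟩ := wordReduce_eq_some hM.op hcl.op rfl h'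
      rw [wordEval_singleton] at h₂ hl h₃
      refine ⟨(u.map (wordEval s)).length + 2, j, ?_⟩
      simp only [List.map_append, List.map_cons, wordEval_append]
      exact RedAt.odd (by simpa using hu.add_even even_two) rfl (MulOpposite.op_injective h₂)
        (isLeftLcm_iff_op.2 hl) (MulOpposite.op_injective h₃)
  · obtain ⟨j, -, h⟩ := List.mem_filterMap.1 h
    obtain ⟨a₁, a₂, b₁, b₂, v, rfl, rfl, h₁, h₂⟩ := headSimplify_eq_some h
    have h₁ := wordDiv_eq_some hM.op hcl.op rfl h₁
    have h₂ := wordDiv_eq_some hM.op hcl.op rfl h₂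
    rw [wordEval_singleton] at h₁ h₂
    exact ⟨1, j, .one (MulOpposite.op_injective h₁) (MulOpposite.op_injective h₂)⟩

/-- With `redAt_of_mem_wordReducts`, evaluation of words is a bisimulation: an atomic step lifts
whichever words represent the entries. -/
theorem exists_mem_wordReducts (hM : IsGcdMonoid M) (hs : ∀ j, IsMonoidAtom (s j))
    (hcr : IsRightComplement (wordEval s) cr) (hcl : IsLeftComplement (wordEval s) cl)
    {t : List (List (Fin n))} {b : List M} {i : ℕ} {j : Fin n}
    (h : RedAt i (s j) (t.map (wordEval s)) b) :
    ∃ r ∈ wordReducts cr cl t, r.map (wordEval s) = b := by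
  have hr₁ : ∀ w, wordEval s w = 1 → w = [] := fun w => eq_nil_of_wordEval_eq_one hM hs
  have hl₁ : ∀ w, MulOpposite.op (wordEval s w) = 1 → w = [] :=
    fun w hw => hr₁ w (MulOpposite.op_injective hw)
  generalize ht : t.map (wordEval s) = a at h
  cases h with
  | @one _ a₁ a₂ b₁ b₂ v h₁ h₂ =>
    obtain ⟨a₁, t, rfl, rfl, ht1⟩ := List.map_eq_cons_iff.1 ht
    obtain ⟨a₂, t, rfl, rfl, rfl⟩ := List.map_eq_cons_iff.1 ht1
    rw [← wordEval_singleton s j] at h₁ h₂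
    obtain ⟨d₁, hd₁, h₁⟩ := exists_wordDiv_eq_some hM.op hcl.op hl₁ (congrArg MulOpposite.op h₁)
    obtain ⟨d₂, hd₂, h₂⟩ := exists_wordDiv_eq_some hM.op hcl.op hl₁ (congrArg MulOpposite.op h₂)
    refine ⟨d₁ :: d₂ :: t, List.mem_append_right _ (List.mem_filterMap.2
      ⟨j, List.mem_finRange j, by simp [headSimplify, hd₁, hd₂]⟩), ?_⟩
    simp [MulOpposite.op_injective h₁, MulOpposite.op_injective h₂]
  | @even u v _ x' a₁ a₂ a₃ b₁ b₂ b₃ hi h₁ h₂ hl h₃ =>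
    obtain ⟨u, t, rfl, rfl, ht1⟩ := List.map_eq_append_iff.1 ht
    obtain ⟨a₁, t, rfl, rfl, ht2⟩ := List.map_eq_cons_iff.1 ht1
    obtain ⟨a₂, t, rfl, rfl, ht3⟩ := List.map_eq_cons_iff.1 ht2
    obtain ⟨a₃, t, rfl, rfl, rfl⟩ := List.map_eq_cons_iff.1 ht3
    rw [← wordEval_singleton s j] at hl h₂ h₃
    obtain ⟨x₁, d₂, d₃, hd, rfl, rfl, rfl⟩ := exists_wordReduce_eq_some hM hcr hr₁ h₂ hl h₃
    refine ⟨u ++ (a₁ ++ x₁) :: d₂ :: d₃ :: t, List.mem_append_left _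
      ((mem_alternatingRewrites (by simp)).1 (.inl ⟨?_, List.mem_filterMap.2
        ⟨j, List.mem_finRange j, by simp [headReduce, hd]⟩⟩)), by simp [h₁]⟩
    simpa [Nat.even_add] using hi
  | @odd u v _ x' a₁ a₂ a₃ b₁ b₂ b₃ hi h₁ h₂ hl h₃ =>
    obtain ⟨u, t, rfl, rfl, ht1⟩ := List.map_eq_append_iff.1 ht
    obtain ⟨a₁, t, rfl, rfl, ht2⟩ := List.map_eq_cons_iff.1 ht1
    obtain ⟨a₂, t, rfl, rfl, ht3⟩ := List.map_eq_cons_iff.1 ht2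
    obtain ⟨a₃, t, rfl, rfl, rfl⟩ := List.map_eq_cons_iff.1 ht3
    rw [← wordEval_singleton s j] at hl h₂ h₃
    obtain ⟨x₁, d₂, d₃, hd, hx, hd₂, hd₃⟩ := exists_wordReduce_eq_some hM.op hcl.op hl₁
      (congrArg MulOpposite.op h₂) (isLeftLcm_iff_op.1 hl) (congrArg MulOpposite.op h₃)
    obtain rfl := MulOpposite.op_injective hx
    obtain rfl := MulOpposite.op_injective hd₂
    obtain rfl := MulOpposite.op_injective hd₃
    refine ⟨u ++ (x₁ ++ a₁) :: d₂ :: d₃ :: t, List.mem_append_left _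
      ((mem_alternatingRewrites (by simp)).1 (.inr ⟨?_, List.mem_filterMap.2
        ⟨j, List.mem_finRange j, by simp [headReduce, hd]⟩⟩)), by simp [h₁]⟩
    simpa [Nat.odd_add] using hi

end WordReduction

end MultifractionReduction

/-! ### Invariance, atomic generation and termination of reduction. -/

namespace MultifractionReduction

open Relation

section Reduction

variable {M : Type*} [Monoid M]

theorem multifractionValue_cons (a : M) (l : List M) :
    multifractionValue (a :: l) = can M a * multifractionValue (1 :: l) := by
  cases l <;> simp [multifractionValue, mul_assoc]

theorem multifractionValue_one_cons (a : M) (l : List M) :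
    multifractionValue (1 :: a :: l) = (can M a)⁻¹ * multifractionValue l := by
  simp [multifractionValue]

theorem multifractionValue_append {u : List M} (hu : Even u.length) (t : List M) :
    multifractionValue (u ++ t) = multifractionValue u * multifractionValue t := by
  match u with
  | [] => simp [multifractionValue]
  | [_] => simp at hu
  | a :: b :: u =>
    have hu' : Even u.length := by simpa [Nat.even_add] using hu
    simp [multifractionValue, multifractionValue_append hu' t, mul_assoc]

/-- After an odd prefix the exponents are shifted; the additional entry `1` restores their parity.
-/
theorem multifractionValue_append_of_odd {u : List M} (hu : Odd u.length) (t : List M) :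
    multifractionValue (u ++ t) = multifractionValue u * multifractionValue (1 :: t) := by
  match u with
  | [] => simp at hu
  | [a] => simpa [multifractionValue] using multifractionValue_cons a t
  | a :: b :: u =>
    have hu' : Odd u.length := by simpa [Nat.odd_add] using hu
    simp [multifractionValue, multifractionValue_append_of_odd hu' t, mul_assoc]

/-- At an even level, `x * b₂ = a₂ * x'` becomes `x' b₂⁻¹ = a₂⁻¹ x` in the group, and `x` is
absorbed in `a₃ = x * b₃`; odd levels are symmetric. -/
theorem RedAt.multifractionValue_eq {i : ℕ} {x : M} {a b : List M} (h : RedAt i x a b) :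
    multifractionValue b = multifractionValue a := by
  cases h with
  | one h₁ h₂ =>
    subst h₁ h₂
    simp [multifractionValue]
  | @even u v _ x' a₁ a₂ a₃ b₁ b₂ b₃ hi h₁ h₂ hl h₃ =>
    subst h₁ h₃
    have hu : Even u.length := by simpa [Nat.even_add] using hi
    rw [multifractionValue_append hu, multifractionValue_append hu]
    have h := congrArg (can M) h₂
    simp only [map_mul] at h
    have h' : can M x' * (can M b₂)⁻¹ = (can M a₂)⁻¹ * can M x := by
      rw [mul_inv_eq_iff_eq_mul, mul_assoc, h, inv_mul_cancel_left]
    simp only [multifractionValue]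
    rw [multifractionValue_cons b₃, multifractionValue_cons (x * b₃), map_mul, map_mul,
      mul_assoc (can M a₁), h']
    simp only [mul_assoc]
  | @odd u v _ x' a₁ a₂ a₃ b₁ b₂ b₃ hi h₁ h₂ hl h₃ =>
    subst h₁ h₃
    have hu : Odd u.length := by simpa [Nat.odd_add] using hi
    rw [multifractionValue_append_of_odd hu, multifractionValue_append_of_odd hu]
    have h := congrArg (can M) h₂
    simp only [map_mul] at h
    have h' : (can M x')⁻¹ * can M b₂ = can M a₂ * (can M x)⁻¹ := by
      rw [inv_mul_eq_iff_eq_mul, ← mul_assoc, ← h, mul_inv_cancel_right]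
    rw [multifractionValue_one_cons, multifractionValue_one_cons]
    simp only [multifractionValue, map_mul, mul_inv_rev]
    rw [mul_assoc (can M a₁)⁻¹, ← mul_assoc (can M x')⁻¹, ← mul_assoc (can M x')⁻¹, h']
    simp only [mul_assoc]

/-- Converse of `IsRightLcm.mul`: the lcm rectangle of `y * z` and `a` is cut into one for `y` and
`a` and one for `z` and the remainder `p`. Uniqueness of lcms identifies the outer sides. -/
theorem IsRightLcm.split (hM : IsGcdMonoid M) {y z a x' b : M}
    (hl : IsRightLcm (y * z) a (a * x')) (h : y * z * b = a * x') :
    ∃ p q t, y * p = a * q ∧ IsRightLcm y a (a * q) ∧ z * b = p * t ∧ IsRightLcm z p (p * t) ∧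
      x' = q * t := by
  have := hM.cancel
  have hab : LeftDvd a (y * (z * b)) := ⟨x', by rw [← mul_assoc, h]⟩
  obtain ⟨p, hp⟩ := hM.exists_rightLcm ⟨z * b, rfl⟩ hab
  obtain ⟨hz, hpz⟩ := LeftDvd.of_mul_mul_of_isRightLcm hM hp ⟨b, (mul_assoc _ _ _).symm⟩ hab
  obtain ⟨r, hr⟩ := hM.exists_rightLcm hz hpz
  obtain rfl : r = b := mul_left_cancel (a := y * z)
    (by rw [h]; exact (hp.mul hM hr).unique hM hl)
  obtain ⟨q, hq⟩ := hp.2.1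
  obtain ⟨t, ht⟩ := hpz
  refine ⟨p, q, t, hq, hq ▸ hp, ht, ht ▸ hr, mul_left_cancel (a := a) ?_⟩
  rw [← h, mul_assoc, ht, ← mul_assoc, hq, mul_assoc]

theorem IsLeftLcm.split (hM : IsGcdMonoid M) {y z a x' b : M}
    (hl : IsLeftLcm (z * y) a (x' * a)) (h : b * (z * y) = x' * a) :
    ∃ p q t, p * y = q * a ∧ IsLeftLcm y a (q * a) ∧ b * z = t * p ∧ IsLeftLcm z p (t * p) ∧
      x' = t * q := by
  obtain ⟨p, q, t, h₁, h₂, h₃, h₄, h₅⟩ :=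
    IsRightLcm.split hM.op (isLeftLcm_iff_op.1 hl) (congrArg MulOpposite.op h)
  exact ⟨p.unop, q.unop, t.unop, MulOpposite.op_injective h₁, isLeftLcm_iff_op.2 h₂,
    MulOpposite.op_injective h₃, isLeftLcm_iff_op.2 h₄, MulOpposite.op_injective h₅⟩

/-- Reducing by a product amounts to reducing by the factors in some order. -/
theorem RedAt.split (hM : IsGcdMonoid M) {i : ℕ} {y z : M} {a b : List M}
    (h : RedAt i (y * z) a b) : (∃ c, RedAt i y a c ∧ RedAt i z c b) ∨
      ∃ c, RedAt i z a c ∧ RedAt i y c b := by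
  generalize hx : y * z = x at h
  cases h with
  | one h₁ h₂ =>
    subst hx
    -- Here the parameter is divided out on the right, so the right factor `z` goes first; odd
    -- levels behave alike, and even levels start with `y`.
    exact .inr ⟨_, .one (by rw [mul_assoc]; exact h₁) (by rw [mul_assoc]; exact h₂),
      .one rfl rfl⟩
  | even hi h₁ h₂ hl h₃ =>
    subst hx
    obtain ⟨p, q, t, h₄, h₅, h₆, h₇, rfl⟩ := hl.split hM h₂
    exact .inl ⟨_, .even hi rfl h₄ h₅ (by rw [← mul_assoc]; exact h₃),
      .even hi (by rw [h₁, mul_assoc]) h₆ h₇ rfl⟩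
  | odd hi h₁ h₂ hl h₃ =>
    subst hx
    obtain ⟨p, q, t, h₄, h₅, h₆, h₇, rfl⟩ := hl.split hM h₂
    exact .inr ⟨_, .odd hi rfl h₄ h₅ (by rw [mul_assoc]; exact h₃),
      .odd hi (by rw [h₁, mul_assoc]) h₆ h₇ rfl⟩

/-- Reduction is generated by the reductions whose parameter is an atom. -/
theorem Reduces.reflTransGen_atom (hM : IsGcdMonoid M) (hn : StronglyNoetherian M) {a b : List M}
    (h : Reduces a b) :
    ReflTransGen (fun a b => ∃ i x, IsMonoidAtom x ∧ RedAt i x a b) a b := by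
  obtain ⟨i, x, hx, h⟩ := h
  refine hn.atom_induction hM (p := fun x => ∀ a b, RedAt i x a b →
    ReflTransGen (fun a b => ∃ i x, IsMonoidAtom x ∧ RedAt i x a b) a b) ?_ ?_ x hx a b h
  · exact fun x hx a b h => .single ⟨i, x, hx, h⟩
  · intro y z _ _ hy hz a b h
    rcases h.split hM with ⟨c, h₁, h₂⟩ | ⟨c, h₁, h₂⟩
    · exact (hy _ _ h₁).trans (hz _ _ h₂)
    · exact (hz _ _ h₁).trans (hy _ _ h₂)

/-- Reduction decreases the reversed sequence of lengths lexicographically. -/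
theorem RedAt.shortlex {l : M → ℕ} (h₁ : ∀ a, l a = 0 ↔ a = 1)
    (h₂ : ∀ a b, l a + l b ≤ l (a * b)) {i : ℕ} {x : M} (hx : x ≠ 1) {a b : List M}
    (h : RedAt i x a b) :
    List.Shortlex (· < ·) (b.map l).reverse (a.map l).reverse := by
  have hx' := mt (h₁ x).1 hx
  cases h with
  | @one _ _ _ b₁ b₂ v h h' =>
    subst h h'
    have := h₂ b₂ x
    simp only [List.map_cons, List.reverse_cons, List.append_assoc]
    -- The last modified entry loses a factor `x ≠ 1` and later entries are unchanged. Reversal puts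
    -- that entry first, so growth of earlier entries does not matter.
    exact (List.Shortlex.of_lex (by simp) (.rel (by omega))).append_left _
  | @even u v _ x' a₁ a₂ a₃ b₁ b₂ b₃ _ _ _ _ h =>
    subst h
    have := h₂ x b₃
    simp only [List.map_cons, List.map_append, List.reverse_append, List.reverse_cons,
      List.append_assoc]
    exact (List.Shortlex.of_lex (by simp) (.rel (by omega))).append_left _
  | @odd u v _ x' a₁ a₂ a₃ b₁ b₂ b₃ _ _ _ _ h =>
    subst h
    have := h₂ b₃ x
    simp only [List.map_cons, List.map_append, List.reverse_append, List.reverse_cons,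
      List.append_assoc]
    exact (List.Shortlex.of_lex (by simp) (.rel (by omega))).append_left _

theorem multifractionValue_trivial_append (k : ℕ) (a : List M) :
    multifractionValue (trivialMultifraction M (2 * k) ++ a) = multifractionValue a := by
  induction k with
  | zero => rfl
  | succ k ih =>
    rw [trivialMultifraction, mul_add, mul_one, List.replicate_succ, List.replicate_succ]
    simpa [multifractionValue, trivialMultifraction] using ih

theorem multifractionValue_trivial : ∀ k : ℕ, multifractionValue (trivialMultifraction M k) = 1
  | 0 => rfl
  | 1 => by simp [trivialMultifraction, multifractionValue]
  | k + 2 => by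
    simpa [trivialMultifraction, List.replicate_succ, multifractionValue] using
      multifractionValue_trivial k

/-- Even depth makes concatenation represent the product. -/
theorem exists_multifractionValue_eq (x : EnvelopingGroup M) :
    ∃ a : List M, Even a.length ∧ multifractionValue a = x := by
  let p (x : EnvelopingGroup M) : Prop := ∃ a : List M, Even a.length ∧ multifractionValue a = x
  have hmul {x y : EnvelopingGroup M} : p x → p y → p (x * y) := by
    rintro ⟨a, ha, rfl⟩ ⟨b, hb, rfl⟩
    exact ⟨a ++ b, by simpa using ha.add hb, multifractionValue_append ha b⟩
  have hone : p 1 := ⟨[], by simp, rfl⟩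
  let H : Subgroup (EnvelopingGroup M) :=
    { carrier := {x | p x ∧ p x⁻¹}
      mul_mem' := fun {x y} hx hy => ⟨hmul hx.1 hy.1, by rw [mul_inv_rev]; exact hmul hy.2 hx.2⟩
      one_mem' := ⟨hone, by rw [inv_one]; exact hone⟩
      inv_mem' := fun {x} hx => ⟨hx.2, by rw [inv_inv]; exact hx.1⟩ }
  refine (PresentedGroup.generated_by _ H (fun a => ?_) x).1
  exact ⟨⟨[a, 1], by simp, by simp [multifractionValue]; rfl⟩,
    ⟨[1, a], by simp, by simp [multifractionValue]; rfl⟩⟩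

theorem enveloping_fg (hM : IsGcdMonoid M) (hn : StronglyNoetherian M) {n : ℕ} {s : Fin n → M}
    (hs : ∀ a, IsMonoidAtom a → ∃ j, s j = a) : Group.FG (EnvelopingGroup M) := by
  refine Group.fg_iff.2 ⟨Set.range fun j => can M (s j), eq_top_iff.2 fun x _ => ?_,
    Set.finite_range _⟩
  refine PresentedGroup.generated_by _ _ (fun a => ?_) x
  obtain ⟨w, rfl⟩ := exists_wordEval_eq hM hn hs a
  change can M _ ∈ _
  rw [wordEval, map_list_prod]
  refine Subgroup.list_prod_mem _ fun y hy => ?_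
  obtain ⟨_, hy', rfl⟩ := List.mem_map.1 hy
  obtain ⟨j, -, rfl⟩ := List.mem_map.1 hy'
  exact Subgroup.subset_closure ⟨j, rfl⟩

/-- Reducibility to a trivial multifraction is decidable. -/
theorem computablePred_reflTransGen_trivial (hM : IsGcdMonoid M) (hn : StronglyNoetherian M)
    (hb : FinitelyManyBasic M) {n : ℕ} {s : Fin n → M}
    (hs : ∀ a, IsMonoidAtom a ↔ ∃ j, s j = a) :
    ComputablePred fun t : List (List (Fin n)) =>
      ReflTransGen Reduces (t.map (wordEval s)) (trivialMultifraction M t.length) := by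
  have hs' (j : Fin n) : IsMonoidAtom (s j) := (hs _).2 ⟨j, rfl⟩
  obtain ⟨cr, hcr, hr⟩ := exists_primrec_isRightComplement hM hn
    (hb.subset fun a ha => .inl ha) hs
  obtain ⟨cl, hcl, hl⟩ := exists_primrec_isLeftComplement hM hn
    (hb.subset fun a ha => .inr ha) hs
  obtain ⟨l, hl₁, hl₂⟩ := hn.exists_length hM
  have wf : WellFounded fun r t => r ∈ wordReducts cr cl t := by
    refine Subrelation.wf (r := InvImage (List.Shortlex (· < ·))
      fun t : List (List (Fin n)) => ((t.map (wordEval s)).map l).reverse) ?_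
      (InvImage.wf _ (List.Shortlex.wf wellFounded_lt))
    intro r t h
    obtain ⟨i, j, h⟩ := redAt_of_mem_wordReducts hM hr hl h
    exact h.shortlex hl₁ hl₂ (hs' j).1
  have hp : PrimrecPred fun t : List (List (Fin n)) => ∀ w ∈ t, w.length = 0 :=
    PrimrecPred.forall_mem_list (Primrec.eq.comp Primrec.list_length (Primrec.const 0))
  refine (computablePred_exists_reachable (primrec_wordReducts hcr hcl) wf hp).of_eq fun t => ?_
  have hred {t r : List (List (Fin n))} (h : r ∈ wordReducts cr cl t) :
      Reduces (t.map (wordEval s)) (r.map (wordEval s)) := by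
    obtain ⟨i, j, h⟩ := redAt_of_mem_wordReducts hM hr hl h
    exact ⟨i, s j, (hs' j).1, h⟩
  have hlen {a b : List M} (h : ReflTransGen Reduces a b) : b.length = a.length := by
    induction h with
    | refl => rfl
    | tail _ h ih =>
      obtain ⟨i, x, -, h⟩ := h
      rw [← ih]
      cases h <;> simp
  constructor
  · rintro ⟨r, htr, hr⟩
    have h : ReflTransGen Reduces (t.map (wordEval s)) (r.map (wordEval s)) :=
      ReflTransGen.lift (List.map (wordEval s)) (fun _ _ => hred) _ _ htr
    have hrep : r.map (wordEval s) = trivialMultifraction M t.length := by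
      refine List.eq_replicate_iff.2 ⟨by simpa using hlen h, fun a ha => ?_⟩
      obtain ⟨w, hw, rfl⟩ := List.mem_map.1 ha
      rw [List.length_eq_zero_iff.1 (hr w hw), wordEval_nil]
    rwa [hrep] at h
  · intro h
    have h' : ReflTransGen (fun a b => ∃ i x, IsMonoidAtom x ∧ RedAt i x a b)
        (t.map (wordEval s)) (trivialMultifraction M t.length) := by
      generalize trivialMultifraction M t.length = b at h
      induction h with
      | refl => exact .refl
      | tail _ h ih => exact ih.trans (h.reflTransGen_atom hM hn)
    have hlift {b : List M} (h : ReflTransGen (fun a b => ∃ i x, IsMonoidAtom x ∧ RedAt i x a b)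
        (t.map (wordEval s)) b) :
        ∃ r, ReflTransGen (fun t r => r ∈ wordReducts cr cl t) t r ∧ r.map (wordEval s) = b := by
      induction h with
      | refl => exact ⟨t, .refl, rfl⟩
      | tail _ h ih =>
        obtain ⟨r, htr, rfl⟩ := ih
        obtain ⟨i, x, hx, h⟩ := h
        obtain ⟨j, rfl⟩ := (hs x).1 hx
        obtain ⟨r', hr', rfl⟩ := exists_mem_wordReducts hM hs' hr hl h
        exact ⟨r', htr.tail hr', rfl⟩
    obtain ⟨r, htr, hr⟩ := hlift h'
    refine ⟨r, htr, fun w hw => List.length_eq_zero_iff.2 (eq_nil_of_wordEval_eq_one hM hs' ?_)⟩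
    exact List.eq_of_mem_replicate (hr ▸ List.mem_map_of_mem hw)

end Reduction

end MultifractionReduction

theorem proposition1p6 {M : Type*} [Monoid M] (hM : IsGcdMonoid M)
    (hnoeth : StronglyNoetherian M) (hbasic : FinitelyManyBasic M)
    (f : List M → ℕ) (hf : IsTuringComputable f) (hsc : SemiConvergentUpTo f) :
    WordProblemDecidable (EnvelopingGroup M) := by
  classical
  obtain ⟨n, e, F, hF, hFf⟩ := hf
  let s : Fin n → M := fun j => e j
  have hs (a : M) : IsMonoidAtom a ↔ ∃ j, s j = a := by
    refine ⟨fun ha => ⟨e.symm ⟨a, ha⟩, by simp [s]⟩, ?_⟩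
    rintro ⟨j, rfl⟩
    exact (e j).2
  have hFf' (t : List (List (Fin n))) : F t = f (t.map (wordEval s)) := hFf t
  refine ⟨enveloping_fg hM hnoeth fun a => (hs a).1, fun m g _ => ?_⟩
  have hG (q : Fin m × Bool) : ∃ t : List (List (Fin n)), Even t.length ∧
      multifractionValue (t.map (wordEval s)) = cond q.2 (g q.1) (g q.1)⁻¹ := by
    obtain ⟨a, ha, h⟩ := exists_multifractionValue_eq (cond q.2 (g q.1) (g q.1)⁻¹)
    choose R hR using exists_wordEval_eq hM hnoeth fun a => (hs a).1
    exact ⟨a.map R, by simpa using ha, by simp [Function.comp_def, hR, h]⟩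
  choose G hGe hG using hG
  have hval (w : List (Fin m × Bool)) : multifractionValue ((w.flatMap G).map (wordEval s)) =
      FreeGroup.lift g (FreeGroup.mk w) := by
    rw [FreeGroup.lift_mk]
    induction w with
    | nil => rfl
    | cons q w ih =>
      rw [List.flatMap_cons, List.map_append, multifractionValue_append (by simpa using hGe q),
        hG, ih, List.map_cons, List.prod_cons]
  have hpad : Primrec₂ fun (k : ℕ) (t : List (List (Fin n))) =>
      (List.range (2 * k)).map (fun _ => ([] : List (Fin n))) ++ t :=
    Primrec.list_append.comp (Primrec.list_map (Primrec.list_range.comp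
      (Primrec.nat_mul.comp (Primrec.const 2) Primrec.fst)) (Primrec.const []).to₂) Primrec.snd
  have hflat : Primrec fun w : List (Fin m × Bool) => w.flatMap G :=
    Primrec.list_flatMap Primrec.id ((Primrec.dom_finite G).comp Primrec.snd).to₂
  have hcomp := (computablePred_reflTransGen_trivial hM hnoeth hbasic hs).decide.comp
    (hpad.to_comp.comp (hF.comp hflat.to_comp) hflat.to_comp)
  refine hcomp.computablePred.of_eq fun w => ?_
  rw [← hval]
  generalize w.flatMap G = t
  have hmap : ((List.range (2 * F t)).map (fun _ => ([] : List (Fin n))) ++ t).map (wordEval s) =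
      trivialMultifraction M (2 * f (t.map (wordEval s))) ++ t.map (wordEval s) := by
    simp [trivialMultifraction, hFf']
  have hlen : ((List.range (2 * F t)).map (fun _ => ([] : List (Fin n))) ++ t).length =
      2 * f (t.map (wordEval s)) + (t.map (wordEval s)).length := by
    simp [hFf']
  rw [hmap, hlen]
  refine ⟨fun h => ?_, hsc _⟩
  have hinv {a b : List M} (h : Relation.ReflTransGen Reduces a b) :
      multifractionValue b = multifractionValue a := by
    induction h with
    | refl => rfl
    | tail _ h ih =>
      obtain ⟨i, x, -, h⟩ := h
      rw [← ih, h.multifractionValue_eq]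
  rw [← multifractionValue_trivial_append (f (t.map (wordEval s))), ← hinv h]
  exact multifractionValue_trivial _
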